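/- Let $L\ge 1$. Let $G\in\mathbb{R}^{L\times L}$ be entrywise nonnegative with positive diagonal, let $n,m,w,y\in\mathbb{R}^L$ be entrywise positive vectors and let $\bar P>0$. (In the application $G$ is the matrix of channel gains, $n$ the noise powers, $m$ the power-cost weights, $\bar P$ the power budget, $w$ the rate weights, and $y_l=y_{l2}^{(t)}$ the current value of the auxiliary variables.) Define $F_{lj}=G_{lj}/G_{ll}$ for $l\ne j$, $F_{ll}=0$, $\sigma_l=n_l/G_{ll}$, and $B=(b_{lj})=F+(1/\bar P)\,\sigma m^\top$; let $\rho$ denote the spectral radius. Consider the problem $$\text{maximize }\ \sum_{l} w_l y_l\tilde\gamma_l\quad\text{subject to}\quad \log\rho\big(\mathrm{diag}(e^{\tilde\gamma})B\big)\le 0,\qquad \tilde\gamma\in\mathbb{R}^L. \tag{1}$$ The function $\tilde\gamma\mapsto\log\rho(\mathrm{diag}(e^{\tilde\gamma})B)$ is convex on $\mathbb{R}^L$, so (1) is a convex program, and the following hold. (a) The system $$\sum_i w_i y_i\,\frac{b_{il}z_l}{\sum_j b_{ij}z_j}=w_l y_l\qquad(l=1,\dots,L) \tag{2}$$ has an entrywise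 positive solution $z^*$, and the set of all its entrywise positive solutions is $\{t z^*: t>0\}$. (b) For every entrywise positive solution $z^*$ of (2), the vector $\tilde\gamma^*$ with $\tilde\gamma_l^*=\log\big(z_l^*/(Bz^*)_l\big)$ is the unique optimal solution of (1). (c) There is $q\in(0,1)$, depending only on $B,w,y$, such that for every entrywise positive $z^{(0)}$ the iteration $$z_l^{(k+1)}=\frac{w_l y_l}{\sum_i w_i y_i\,\dfrac{b_{il}}{\sum_j b_{ij}z_j^{(k)}}}$$ converges geometrically fast to some entrywise positive solution $z^*$ of (2): there is a constant $C$ (depending on $z^{(0)}$) with $|z_l^{(k)}-z_l^*|\le C q^k$ for all $k\ge 0$ and all $l$. (d) The Lagrange dual problem of (1), namely to maximize $g(\lambda)=\inf_{\tilde\gamma}\big(-\sum_l w_l y_l\tilde\gamma_l+\lambda\log\rho(\mathrm{diag}(e^{\tilde\gamma})B)\big)$ over $\lambda\ge 0$, has the unique optimal solution $\lambda^*=\sum_l w_l y_l$, and there is no duality gap: $g(\lambda^*)=-\sum_l w_l y_l\tilde\gamma_l^*$. -/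

import Mathlib

noncomputable section

namespace PowerControl

/-- The normalized interference matrix `F`: `0` on the diagonal, `G l j / G l l` off it. -/
def interferenceMatrix {L : ℕ} (G : Matrix (Fin L) (Fin L) ℝ) : Matrix (Fin L) (Fin L) ℝ :=
  Matrix.of fun l j => if l = j then 0 else G l j / G l l

/-- The normalized noise vector `σ`, with entries `n l / G l l`. -/
def normalizedNoise {L : ℕ} (G : Matrix (Fin L) (Fin L) ℝ) (n : Fin L → ℝ) : Fin L → ℝ :=
  fun l => n l / G l l

/-- The matrix `B = F + (1 / P) σ mᵀ`. -/
def constraintMatrix {L : ℕ} (G : Matrix (Fin L) (Fin L) ℝ) (n m : Fin L → ℝ) (P : ℝ) :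
    Matrix (Fin L) (Fin L) ℝ :=
  interferenceMatrix G + (1 / P) • Matrix.vecMulVec (normalizedNoise G n) m

/-- The spectral radius of a real square matrix: the largest modulus of its complex
eigenvalues. -/
def specRadius {L : ℕ} (A : Matrix (Fin L) (Fin L) ℝ) : ℝ :=
  (spectralRadius ℂ (A.map (fun x : ℝ => (x : ℂ)))).toReal

/-- The constraint function `γ ↦ log ρ(diag(e^γ) B)`. For an entrywise positive `B` of size at
least one the spectral radius is positive, so the logarithm is a genuine one. -/
def logRho {L : ℕ} (B : Matrix (Fin L) (Fin L) ℝ) (γ : Fin L → ℝ) : ℝ :=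
  Real.log (specRadius (Matrix.diagonal (fun l => Real.exp (γ l)) * B))

/-- The objective `∑ w_l y_l γ_l`. -/
def objective {L : ℕ} (w y γ : Fin L → ℝ) : ℝ := ∑ l, w l * y l * γ l

/-- `γ` is an optimal solution of: maximize `∑ w_l y_l γ_l` subject to
`log ρ(diag(e^γ) B) ≤ 0`. -/
def IsOptimal {L : ℕ} (B : Matrix (Fin L) (Fin L) ℝ) (w y γ : Fin L → ℝ) : Prop :=
  logRho B γ ≤ 0 ∧ ∀ γ' : Fin L → ℝ, logRho B γ' ≤ 0 → objective w y γ' ≤ objective w y γ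

/-- The Lagrangian of the problem written as: minimize `-∑ w_l y_l γ_l` subject to
`log ρ(diag(e^γ) B) ≤ 0`. -/
def lagrangian {L : ℕ} (B : Matrix (Fin L) (Fin L) ℝ) (w y : Fin L → ℝ) (γ : Fin L → ℝ)
    (lam : ℝ) : ℝ :=
  -objective w y γ + lam * logRho B γ

/-- The Lagrange dual function, with values in the extended reals. -/
def dualFunction {L : ℕ} (B : Matrix (Fin L) (Fin L) ℝ) (w y : Fin L → ℝ) (lam : ℝ) : EReal :=
  ⨅ γ : Fin L → ℝ, ((lagrangian B w y γ lam : ℝ) : EReal)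

/-- `lam` is an optimal solution of the dual problem: maximize the dual function over
`lam ≥ 0`. -/
def IsDualOptimal {L : ℕ} (B : Matrix (Fin L) (Fin L) ℝ) (w y : Fin L → ℝ) (lam : ℝ) : Prop :=
  0 ≤ lam ∧ ∀ mu : ℝ, 0 ≤ mu → dualFunction B w y mu ≤ dualFunction B w y lam

/-- `z` is an entrywise positive solution of
`∑_i w_i y_i b_{il} z_l / ∑_j b_{ij} z_j = w_l y_l` for all `l`. -/
def IsPositiveSolution {L : ℕ} (B : Matrix (Fin L) (Fin L) ℝ) (w y z : Fin L → ℝ) : Prop :=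
  (∀ l, 0 < z l) ∧
    ∀ l, ∑ i, w i * y i * (B i l * z l / ∑ j, B i j * z j) = w l * y l

/-- One step of the fixed-point iteration,
`z_l ↦ w_l y_l / ∑_i w_i y_i (b_{il} / ∑_j b_{ij} z_j)`. -/
def step {L : ℕ} (B : Matrix (Fin L) (Fin L) ℝ) (w y z : Fin L → ℝ) : Fin L → ℝ :=
  fun l => w l * y l / ∑ i, w i * y i * (B i l / ∑ j, B i j * z j)

/-- The vector with entries `log (z_l / (B z)_l)`. -/
def logRatio {L : ℕ} (B : Matrix (Fin L) (Fin L) ℝ) (z : Fin L → ℝ) : Fin L → ℝ :=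
  fun l => Real.log (z l / (B.mulVec z) l)

end PowerControl

end

/-! Write `v l = w l * y l` and `V = ∑ l, v l`. Two independent mechanisms carry the proof.

Contraction (Birkhoff–Hopf): a positive matrix shrinks the spread of the ratios `z i / z' i` by a
factor `κ < 1` (`SpreadLE.mulVec`). The iteration composes `B`, entrywise inversion, `Bᵀ` and
inversion again, so it contracts as well. Contraction only controls directions; the scale is
controlled because the `v`-weighted mean of `z l / step z l` is 1. Hence iterates converge
geometrically (`exists_geometric_limit`), and the limit is a positive fixed point. The same argument
yields Perron eigenvectors.

Entropy: at a solution `z` the array `p i j = v i * B i j * z j / (B z) i` has row and column sums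
`v`. Then `log s ≤ s - 1` shows that `z` maximizes `∑ v l * log (x l / (B x) l)` over positive `x`,
uniquely up to scale (`IsPositiveSolution.sum_log_le`). Every `γ` equals `logRho B γ + log (x / B
x)` for a Perron vector `x`, so `objective γ ≤ V * logRho B γ + objective (logRatio B z)`. This one
inequality and its equality case give the optimum, its uniqueness and the multiplier `V`. -/

open Filter Topology

/-! ### Projective contraction by positive matrices -/

namespace PowerControl

variable {ι : Type*}

/-- The ratios `z i / z' i` of two positive vectors agree up to a factor `1 + E`. -/
def SpreadLE (E : ℝ) (z z' : ι → ℝ) : Prop :=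
  ∀ i k, z i * z' k ≤ (1 + E) * (z k * z' i)

/-- Cross-multiplied cross ratios of a matrix are at least `1 - κ`. -/
def CrossRatioBound (κ : ℝ) (A : Matrix ι ι ℝ) : Prop :=
  ∀ i j k l, (1 - κ) * (A k j * A i l) ≤ A i j * A k l

theorem exists_crossRatioBound [Finite ι] [Nonempty ι] {A : Matrix ι ι ℝ}
    (hA : ∀ i j, 0 < A i j) : ∃ κ, 0 < κ ∧ κ < 1 ∧ CrossRatioBound κ A := by
  obtain ⟨p, hp⟩ := Finite.exists_min
    (fun p : ι × ι × ι × ι => A p.1 p.2.1 * A p.2.2.1 p.2.2.2 / (A p.2.2.1 p.2.1 * A p.1 p.2.2.2))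
  set e := A p.1 p.2.1 * A p.2.2.1 p.2.2.2 / (A p.2.2.1 p.2.1 * A p.1 p.2.2.2) with he
  have he0 : 0 < e := div_pos (mul_pos (hA _ _) (hA _ _)) (mul_pos (hA _ _) (hA _ _))
  have he1 : e ≤ 1 := by
    obtain ⟨a⟩ := ‹Nonempty ι›
    have h := hp (a, a, a, a)
    rwa [div_self (mul_pos (hA _ _) (hA _ _)).ne'] at h
  -- Halving `e` keeps `κ` strictly positive even when all cross ratios are 1 (rank one); `κ` later
  -- serves as the rate `q > 0`.
  refine ⟨1 - e / 2, by linarith, by linarith, fun i j k l => ?_⟩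
  have hpos := mul_pos (hA k j) (hA i l)
  have h := hp (i, j, k, l)
  rw [le_div_iff₀ hpos] at h
  nlinarith [mul_pos he0 hpos]

theorem exists_spreadLE [Finite ι] {z z' : ι → ℝ} (hz : ∀ i, 0 < z i) (hz' : ∀ i, 0 < z' i) :
    ∃ E, 0 ≤ E ∧ SpreadLE E z z' := by
  have := Fintype.ofFinite ι
  have hpos : ∀ p : ι × ι, 0 < z p.1 * z' p.2 / (z p.2 * z' p.1) := fun p =>
    div_pos (mul_pos (hz _) (hz' _)) (mul_pos (hz _) (hz' _))
  refine ⟨∑ p : ι × ι, z p.1 * z' p.2 / (z p.2 * z' p.1),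
    Finset.sum_nonneg fun p _ => (hpos p).le, fun i k => ?_⟩
  have h := Finset.single_le_sum (f := fun p : ι × ι => z p.1 * z' p.2 / (z p.2 * z' p.1))
    (fun p _ => (hpos p).le) (Finset.mem_univ (i, k))
  have hd := mul_pos (hz k) (hz' i)
  rw [div_le_iff₀ hd] at h
  linarith

/-- The weights cancel and inversion swaps the roles of `i` and `k`, over both of which `SpreadLE`
quantifies. -/
theorem SpreadLE.div {E : ℝ} {v z z' : ι → ℝ} (hv : ∀ i, 0 < v i) (hz : ∀ i, 0 < z i)
    (hz' : ∀ i, 0 < z' i) (h : SpreadLE E z z') :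
    SpreadLE E (fun i => v i / z i) (fun i => v i / z' i) := fun i k => by
  have h1 := h k i
  have hi := hz i
  have hk := hz k
  have hi' := hz' i
  have hk' := hz' k
  rw [div_mul_div_comm, div_mul_div_comm, mul_div_assoc', div_le_div_iff₀ (by positivity)
    (by positivity)]
  nlinarith [mul_le_mul_of_nonneg_left h1 (mul_pos (hv i) (hv k)).le]

/-- The excess of `M * p + N * q` over `N * p + M * q` is `(M - N) * (p - q)`. It is nonpositive for
opposite signs; for equal signs one factor gains `κ` and the other `E`. This is the source of the
contraction. -/
theorem cross_term_le {κ E M N p q : ℝ} (hκ : 0 ≤ κ) (hE : 0 ≤ E) (hM : 0 ≤ M) (hN : 0 ≤ N)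
    (hp : 0 ≤ p) (hq : 0 ≤ q) (hMN : (1 - κ) * M ≤ N) (hNM : (1 - κ) * N ≤ M)
    (hpq : p ≤ (1 + E) * q) (hqp : q ≤ (1 + E) * p) :
    M * p + N * q ≤ (1 + κ * E) * (N * p + M * q) := by
  have h1 : 0 ≤ κ * E * (N * p) := by positivity
  have h2 : 0 ≤ κ * E * (M * q) := by positivity
  suffices h : (M - N) * (p - q) ≤ κ * E * (N * p) + κ * E * (M * q) by nlinarith
  rcases le_total M N with hm | hm <;> rcases le_total p q with hr | hr
  · have := mul_le_mul (show N - M ≤ κ * N by linarith) (show q - p ≤ E * p by linarith)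
      (by linarith) (by positivity)
    nlinarith
  · nlinarith [mul_nonneg (sub_nonneg.2 hm) (sub_nonneg.2 hr)]
  · nlinarith [mul_nonneg (sub_nonneg.2 hm) (sub_nonneg.2 hr)]
  · have := mul_le_mul (show M - N ≤ κ * M by linarith) (show p - q ≤ E * q by linarith)
      (by linarith) (by positivity)
    nlinarith

theorem tendsto_of_geometric_bound {f : ℕ → ι → ℝ} {z : ι → ℝ} {C κ : ℝ} (hκ0 : 0 ≤ κ)
    (hκ1 : κ < 1) (h : ∀ k i, |f k i - z i| ≤ C * κ ^ k) : Tendsto f atTop (𝓝 z) := by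
  refine tendsto_pi_nhds.2 fun i => ?_
  rw [tendsto_iff_norm_sub_tendsto_zero]
  refine squeeze_zero (fun _ => norm_nonneg _) (fun k => h k i) ?_
  simpa using (tendsto_pow_atTop_nhds_zero_of_lt_one hκ0 hκ1).const_mul C

variable [Fintype ι]

theorem mulVec_pos [Nonempty ι] {A : Matrix ι ι ℝ} (hA : ∀ i j, 0 < A i j) {z : ι → ℝ}
    (hz : ∀ i, 0 < z i) (i : ι) : 0 < A.mulVec z i :=
  Finset.sum_pos (fun j _ => mul_pos (hA i j) (hz j)) Finset.univ_nonempty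

/-- A positive matrix contracts the spread of two positive vectors. -/
theorem SpreadLE.mulVec {κ E : ℝ} {A : Matrix ι ι ℝ} (hA : ∀ i j, 0 < A i j) (hκ : 0 ≤ κ)
    (hcr : CrossRatioBound κ A) {z z' : ι → ℝ} (hz : ∀ i, 0 < z i) (hz' : ∀ i, 0 < z' i)
    (hE : 0 ≤ E) (h : SpreadLE E z z') : SpreadLE (κ * E) (A.mulVec z) (A.mulVec z') := by
  intro i k
  have key : ∀ a b, A.mulVec z a * A.mulVec z' b
      = ∑ j, ∑ l, A a j * A b l * (z j * z' l) := fun a b => by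
    simp only [Matrix.mulVec, dotProduct, Finset.sum_mul_sum]
    exact Finset.sum_congr rfl fun j _ => Finset.sum_congr rfl fun l _ => by ring
  have key' : ∀ a b, A.mulVec z a * A.mulVec z' b
      = ∑ j, ∑ l, A a l * A b j * (z l * z' j) := fun a b => by
    rw [key, Finset.sum_comm]
  -- Doubling pairs the `(j, l)` term of the double sum with the `(l, j)` term, so that
  -- `cross_term_le` applies termwise.
  have h2 : A.mulVec z i * A.mulVec z' k + A.mulVec z i * A.mulVec z' k ≤
      (1 + κ * E) * (A.mulVec z k * A.mulVec z' i + A.mulVec z k * A.mulVec z' i) := by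
    nth_rewrite 1 [key]
    nth_rewrite 1 [key']
    nth_rewrite 1 [key]
    nth_rewrite 1 [key']
    simp only [← Finset.sum_add_distrib, Finset.mul_sum]
    refine Finset.sum_le_sum fun j _ => Finset.sum_le_sum fun l _ => ?_
    have ht := cross_term_le (M := A i j * A k l) (N := A i l * A k j) (p := z j * z' l)
      (q := z l * z' j) hκ hE (mul_pos (hA _ _) (hA _ _)).le (mul_pos (hA _ _) (hA _ _)).le
      (mul_pos (hz _) (hz' _)).le (mul_pos (hz _) (hz' _)).le (by linarith [hcr k j i l])
      (by linarith [hcr i j k l]) (h j l) (h l j)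
    linarith
  linarith

/-- Iterates of a spread-contracting map, no two consecutive ones of which are strictly ordered,
converge geometrically fast. -/
theorem exists_geometric_limit {S : (ι → ℝ) → ι → ℝ} {κ : ℝ} (hκ0 : 0 < κ) (hκ1 : κ < 1)
    (hpos : ∀ z, (∀ i, 0 < z i) → ∀ i, 0 < S z i)
    (hcontr : ∀ E z z', 0 ≤ E → (∀ i, 0 < z i) → (∀ i, 0 < z' i) → SpreadLE E z z' →
      SpreadLE (κ * E) (S z) (S z'))
    {x : ι → ℝ} (hx : ∀ i, 0 < x i) (hle : ∀ k, ∃ l, S^[k + 1] x l ≤ S^[k] x l)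
    (hge : ∀ k, ∃ l, S^[k] x l ≤ S^[k + 1] x l) :
    ∃ z : ι → ℝ, (∀ i, 0 < z i) ∧ ∃ C : ℝ, ∀ k i, |S^[k] x i - z i| ≤ C * κ ^ k := by
  have hxk : ∀ k i, 0 < S^[k] x i := fun k => by
    induction k with
    | zero => exact hx
    | succ k ih => rw [Function.iterate_succ_apply']; exact hpos _ ih
  obtain ⟨E, hE, hsp⟩ := exists_spreadLE (hxk 1) (hxk 0)
  have hspk : ∀ k, SpreadLE (E * κ ^ k) (S^[k + 1] x) (S^[k] x) := fun k => by
    induction k with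
    | zero => simpa using hsp
    | succ k ih =>
      have := hcontr _ _ _ (by positivity) (hxk _) (hxk _) ih
      rw [← Function.iterate_succ_apply' S, ← Function.iterate_succ_apply' S] at this
      rwa [pow_succ, mul_comm (κ ^ k), mul_left_comm]
  have hlog : ∀ i k, dist (Real.log (S^[k] x i)) (Real.log (S^[k + 1] x i)) ≤ E * κ ^ k := by
    intro i k
    have hlogle : ∀ a b : ℝ, 0 < a → 0 < b → a ≤ (1 + E * κ ^ k) * b →
        Real.log a - Real.log b ≤ E * κ ^ k := fun a b ha hb hab => by
      have hpos : 0 < 1 + E * κ ^ k := by positivity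
      have h1 := Real.log_le_log ha hab
      rw [Real.log_mul hpos.ne' hb.ne'] at h1
      linarith [Real.log_le_sub_one_of_pos hpos]
    -- One coordinate that does not grow and one that does not shrink fix the scale: every ratio of
    -- consecutive iterates lies within a factor `1 + E * κ ^ k` of 1.
    obtain ⟨l, hl⟩ := hle k
    obtain ⟨l', hl'⟩ := hge k
    have hE' : 0 ≤ 1 + E * κ ^ k := by positivity
    rw [Real.dist_eq, abs_sub_le_iff]
    constructor
    · refine hlogle _ _ (hxk _ _) (hxk _ _) ?_
      refine le_of_mul_le_mul_left ?_ (hxk (k + 1) l')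
      calc _ ≤ (1 + E * κ ^ k) * (S^[k + 1] x i * S^[k] x l') := hspk k l' i
        _ ≤ (1 + E * κ ^ k) * (S^[k + 1] x i * S^[k + 1] x l') :=
          mul_le_mul_of_nonneg_left (mul_le_mul_of_nonneg_left hl' (hxk _ _).le) hE'
        _ = _ := by ring
    · refine hlogle _ _ (hxk _ _) (hxk _ _) ?_
      refine le_of_mul_le_mul_right ?_ (hxk k l)
      calc _ ≤ (1 + E * κ ^ k) * (S^[k + 1] x l * S^[k] x i) := hspk k i l
        _ ≤ (1 + E * κ ^ k) * (S^[k] x l * S^[k] x i) :=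
          mul_le_mul_of_nonneg_left (mul_le_mul_of_nonneg_right hl (hxk _ _).le) hE'
        _ = _ := by ring
  choose u hu using fun i => cauchySeq_tendsto_of_complete
    (cauchySeq_of_le_geometric κ E hκ1 (hlog i))
  have hbd : ∀ i k, |Real.log (S^[k] x i) - u i| ≤ E / (1 - κ) * κ ^ k := fun i k => by
    have := dist_le_of_le_geometric_of_tendsto κ E hκ1 (hlog i) (hu i) k
    rwa [Real.dist_eq, mul_div_right_comm] at this
  set D := E / (1 - κ)
  have hD : 0 ≤ D := div_nonneg hE (by linarith)
  -- Convergence holds in logarithmic coordinates, so the limit is positive; summing over `i` makes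
  -- the constant uniform in the coordinate.
  refine ⟨fun i => Real.exp (u i), fun i => Real.exp_pos _,
    ∑ i, Real.exp (u i) * (D * Real.exp D), fun k i => ?_⟩
  have hexp : ∀ d : ℝ, |Real.exp d - 1| ≤ |d| * Real.exp |d| := fun d => by
    rw [abs_le]
    have h1 := Real.add_one_le_exp d
    have h2 := Real.add_one_le_exp (-d)
    have h3 : 1 ≤ Real.exp |d| := Real.one_le_exp (abs_nonneg d)
    have h4 : Real.exp d * Real.exp (-d) = 1 := by rw [← Real.exp_add]; simp
    constructor
    · nlinarith [neg_abs_le d, abs_nonneg d]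
    · have h5 : Real.exp d ≤ Real.exp |d| := Real.exp_le_exp.2 (le_abs_self d)
      have h6 : Real.exp d - 1 ≤ d * Real.exp d := by nlinarith [Real.exp_pos d]
      exact h6.trans (mul_le_mul (le_abs_self d) h5 (Real.exp_pos d).le (abs_nonneg d))
  have hk1 : κ ^ k ≤ 1 := pow_le_one₀ hκ0.le hκ1.le
  have hd := hbd i k
  have hd1 : |Real.log (S^[k] x i) - u i| ≤ D := hd.trans (mul_le_of_le_one_right hD hk1)
  have hfac : S^[k] x i - Real.exp (u i)
      = Real.exp (u i) * (Real.exp (Real.log (S^[k] x i) - u i) - 1) := by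
    rw [mul_sub, ← Real.exp_add, add_sub_cancel, Real.exp_log (hxk k i), mul_one]
  have hsingle := Finset.single_le_sum (f := fun i => Real.exp (u i) * (D * Real.exp D))
    (fun i _ => by positivity) (Finset.mem_univ i)
  calc |S^[k] x i - Real.exp (u i)|
      = Real.exp (u i) * |Real.exp (Real.log (S^[k] x i) - u i) - 1| := by
        rw [hfac, abs_mul, abs_of_pos (Real.exp_pos _)]
    _ ≤ Real.exp (u i) * (D * κ ^ k * Real.exp D) :=
        mul_le_mul_of_nonneg_left ((hexp _).trans (mul_le_mul hd (Real.exp_le_exp.2 hd1)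
          (Real.exp_pos _).le (by positivity))) (Real.exp_pos _).le
    _ = Real.exp (u i) * (D * Real.exp D) * κ ^ k := by ring
    _ ≤ _ := mul_le_mul_of_nonneg_right hsingle (by positivity)

/-! ### Perron eigenvectors -/

/-- A positive matrix has a positive eigenvector. -/
theorem exists_pos_eigenvector [Nonempty ι] {A : Matrix ι ι ℝ} (hA : ∀ i j, 0 < A i j) :
    ∃ x : ι → ℝ, (∀ i, 0 < x i) ∧ ∃ r : ℝ, 0 < r ∧ A.mulVec x = r • x := by
  obtain ⟨κ, hκ0, hκ1, hcr⟩ := exists_crossRatioBound hA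
  obtain ⟨a⟩ := ‹Nonempty ι›
  have : Nonempty ι := ⟨a⟩
  -- Normalizing at `a` keeps that coordinate equal to 1, which supplies both order conditions of
  -- `exists_geometric_limit`.
  let S : (ι → ℝ) → ι → ℝ := fun z i => A.mulVec z i / A.mulVec z a
  have hpos : ∀ z, (∀ i, 0 < z i) → ∀ i, 0 < S z i := fun z hz i =>
    div_pos (mulVec_pos hA hz i) (mulVec_pos hA hz a)
  have hSa : ∀ k, S^[k] (fun _ => 1) a = 1 := fun k => by
    have hxk : ∀ i, 0 < S^[k] (fun _ => 1) i := by
      induction k with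
      | zero => exact fun _ => one_pos
      | succ k ih => rw [Function.iterate_succ_apply']; exact hpos _ ih
    cases k with
    | zero => rfl
    | succ k =>
      rw [Function.iterate_succ_apply'] at hxk ⊢
      have := hxk a
      exact div_self fun h => by simp [S, h] at this
  obtain ⟨z, hz, C, hC⟩ := exists_geometric_limit (S := S) (x := fun _ => 1) hκ0 hκ1 hpos
    (fun E z z' hE hz hz' h i k => by
      have h1 := SpreadLE.mulVec hA hκ0.le hcr hz hz' hE h i k
      have hza := mulVec_pos hA hz a
      have hza' := mulVec_pos hA hz' a
      simp only [S]
      rw [div_mul_div_comm, div_mul_div_comm, mul_div_assoc']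
      exact div_le_div_of_nonneg_right h1 (by positivity))
    (fun _ => one_pos) (fun k => ⟨a, by rw [hSa, hSa]⟩) (fun k => ⟨a, by rw [hSa, hSa]⟩)
  have hcont : ContinuousAt S z := by
    refine continuousAt_pi.2 fun i => ContinuousAt.div ?_ ?_ (mulVec_pos hA hz a).ne'
    all_goals exact (continuous_finsetSum _ fun j _ => by fun_prop).continuousAt
  have hfix : S z = z :=
    isFixedPt_of_tendsto_iterate (tendsto_of_geometric_bound hκ0.le hκ1 hC) hcont
  refine ⟨z, hz, A.mulVec z a, mulVec_pos hA hz a, funext fun i => ?_⟩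
  have h := congrFun hfix i
  rw [div_eq_iff (mulVec_pos hA hz a).ne'] at h
  rw [h, Pi.smul_apply, smul_eq_mul, mul_comm]

end PowerControl

/-! ### Positivity of `B` and Collatz–Wielandt bounds for the spectral radius -/

namespace PowerControl

variable {L : ℕ}

theorem constraintMatrix_pos {G : Matrix (Fin L) (Fin L) ℝ} (hG : ∀ l j, 0 ≤ G l j)
    (hGdiag : ∀ l, 0 < G l l) {n m : Fin L → ℝ} {P : ℝ} (hn : ∀ l, 0 < n l) (hm : ∀ l, 0 < m l)
    (hP : 0 < P) (l j : Fin L) : 0 < constraintMatrix G n m P l j := by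
  have h1 : 0 ≤ interferenceMatrix G l j := by
    simp only [interferenceMatrix, Matrix.of_apply]
    split_ifs
    · exact le_rfl
    · exact div_nonneg (hG _ _) (hGdiag _).le
  have h2 : 0 < 1 / P * (n l / G l l * m j) :=
    mul_pos (one_div_pos.2 hP) (mul_pos (div_pos (hn l) (hGdiag l)) (hm j))
  simpa [constraintMatrix, Matrix.vecMulVec_apply, normalizedNoise] using
    add_pos_of_nonneg_of_pos h1 h2

theorem exists_mulVec_eq_of_mem_spectrum {A : Matrix (Fin L) (Fin L) ℂ} {μ : ℂ}
    (h : μ ∈ spectrum ℂ A) : ∃ v, v ≠ 0 ∧ A.mulVec v = μ • v := by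
  rw [← Matrix.spectrum_toLin', ← Module.End.hasEigenvalue_iff_mem_spectrum] at h
  obtain ⟨v, hv⟩ := h.exists_hasEigenvector
  exact ⟨v, hv.2, by simpa using hv.apply_eq_smul⟩

/-- Collatz–Wielandt upper bound for the eigenvalues of a nonnegative matrix. -/
theorem norm_le_of_mem_spectrum {A : Matrix (Fin L) (Fin L) ℝ} (hA : ∀ i j, 0 ≤ A i j)
    {x : Fin L → ℝ} (hx : ∀ i, 0 < x i) {c : ℝ} (h : ∀ i, A.mulVec x i ≤ c * x i) {μ : ℂ}
    (hμ : μ ∈ spectrum ℂ (A.map (fun x : ℝ => (x : ℂ)))) : ‖μ‖ ≤ c := by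
  obtain ⟨v, hv, hμv⟩ := exists_mulVec_eq_of_mem_spectrum hμ
  obtain ⟨i₀, hi₀⟩ := Function.ne_iff.1 hv
  have : Nonempty (Fin L) := ⟨i₀⟩
  obtain ⟨i, hi⟩ := Finite.exists_max fun i => ‖v i‖ / x i
  set s := ‖v i‖ / x i with hs
  have hs0 : 0 < s := (div_pos (norm_pos_iff.2 hi₀) (hx i₀)).trans_le (hi i₀)
  have hvs : ∀ j, ‖v j‖ ≤ s * x j := fun j => (div_le_iff₀ (hx j)).1 (hi j)
  have hvi : ‖v i‖ = s * x i := by rw [hs, div_mul_cancel₀ _ (hx i).ne']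
  have h1 : ‖μ‖ * (s * x i) ≤ c * (s * x i) := by
    calc ‖μ‖ * (s * x i) = ‖(A.map (fun x : ℝ => (x : ℂ))).mulVec v i‖ := by
          rw [hμv, Pi.smul_apply, smul_eq_mul, norm_mul, hvi]
      _ ≤ ∑ j, A i j * (s * x j) := by
          simp only [Matrix.mulVec, dotProduct, Matrix.map_apply]
          refine (norm_sum_le _ _).trans (Finset.sum_le_sum fun j _ => ?_)
          rw [norm_mul, Complex.norm_real, Real.norm_of_nonneg (hA i j)]
          exact mul_le_mul_of_nonneg_left (hvs j) (hA i j)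
      _ = s * A.mulVec x i := by
          simp only [Matrix.mulVec, dotProduct, Finset.mul_sum]
          exact Finset.sum_congr rfl fun j _ => by ring
      _ ≤ s * (c * x i) := mul_le_mul_of_nonneg_left (h i) hs0.le
      _ = c * (s * x i) := by ring
  exact le_of_mul_le_mul_right h1 (mul_pos hs0 (hx i))

theorem spectralRadius_le_of_mulVec_le {A : Matrix (Fin L) (Fin L) ℝ} (hA : ∀ i j, 0 ≤ A i j)
    {x : Fin L → ℝ} (hx : ∀ i, 0 < x i) {c : ℝ} (h : ∀ i, A.mulVec x i ≤ c * x i) :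
    spectralRadius ℂ (A.map (fun x : ℝ => (x : ℂ))) ≤ ENNReal.ofReal c := by
  refine iSup₂_le fun μ hμ => ?_
  rw [← enorm_eq_nnnorm, ← ofReal_norm]
  exact ENNReal.ofReal_le_ofReal (norm_le_of_mem_spectrum hA hx h hμ)

theorem specRadius_le_of_mulVec_le {A : Matrix (Fin L) (Fin L) ℝ} (hA : ∀ i j, 0 ≤ A i j)
    {x : Fin L → ℝ} (hx : ∀ i, 0 < x i) {c : ℝ} (hc : 0 ≤ c) (h : ∀ i, A.mulVec x i ≤ c * x i) :
    specRadius A ≤ c :=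
  ENNReal.toReal_le_of_le_ofReal hc (spectralRadius_le_of_mulVec_le hA hx h)

theorem specRadius_eq_of_mulVec_eq [Nonempty (Fin L)] {A : Matrix (Fin L) (Fin L) ℝ}
    (hA : ∀ i j, 0 ≤ A i j) {x : Fin L → ℝ} (hx : ∀ i, 0 < x i) {c : ℝ} (hc : 0 ≤ c)
    (h : A.mulVec x = c • x) : specRadius A = c := by
  have hle : ∀ i, A.mulVec x i ≤ c * x i := fun i => (congrFun h i).le
  refine le_antisymm (specRadius_le_of_mulVec_le hA hx hc hle) ?_
  have hmem : (c : ℂ) ∈ spectrum ℂ (A.map (fun x : ℝ => (x : ℂ))) := by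
    rw [← Matrix.spectrum_toLin', ← Module.End.hasEigenvalue_iff_mem_spectrum]
    refine Module.End.hasEigenvalue_of_hasEigenvector (x := fun i => (x i : ℂ)) ?_
    refine Module.End.hasEigenvector_iff.2
      ⟨Module.End.mem_eigenspace_iff.2 (funext fun i => ?_), fun h0 => ?_⟩
    · have hi := congrArg (fun r : ℝ => (r : ℂ)) (congrFun h i)
      simpa [Matrix.mulVec, dotProduct] using hi
    · obtain ⟨i⟩ := ‹Nonempty (Fin L)›
      have := congrFun h0 i
      simp [(hx i).ne'] at this
  have hbd := le_iSup₂ (f := fun (k : ℂ) (_ : k ∈ spectrum ℂ (A.map (fun x : ℝ => (x : ℂ)))) =>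
    (‖k‖₊ : ENNReal)) (c : ℂ) hmem
  -- Finiteness matters because `toReal` sends `⊤` to 0.
  have hfin : spectralRadius ℂ (A.map (fun x : ℝ => (x : ℂ))) ≠ ⊤ :=
    ne_top_of_le_ne_top ENNReal.ofReal_ne_top (spectralRadius_le_of_mulVec_le hA hx hle)
  have := ENNReal.toReal_mono hfin hbd
  rw [← specRadius] at this
  simpa [abs_of_nonneg hc] using this

/-! ### The constraint function and its convexity -/

theorem diagonal_exp_mul_apply (B : Matrix (Fin L) (Fin L) ℝ) (γ : Fin L → ℝ) (i j : Fin L) :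
    (Matrix.diagonal (fun l => Real.exp (γ l)) * B) i j = Real.exp (γ i) * B i j := by
  simp

theorem diagonal_exp_mul_mulVec (B : Matrix (Fin L) (Fin L) ℝ) (γ x : Fin L → ℝ) (i : Fin L) :
    (Matrix.diagonal (fun l => Real.exp (γ l)) * B).mulVec x i
      = Real.exp (γ i) * B.mulVec x i := by
  rw [← Matrix.mulVec_mulVec, Matrix.mulVec_diagonal]

variable [Nonempty (Fin L)] {B : Matrix (Fin L) (Fin L) ℝ}

theorem logRho_eq_of_eigenvector (hB : ∀ i j, 0 < B i j) {γ x : Fin L → ℝ}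
    (hx : ∀ i, 0 < x i) {c : ℝ} (h : ∀ i, Real.exp (γ i) * B.mulVec x i = Real.exp c * x i) :
    logRho B γ = c := by
  rw [logRho, specRadius_eq_of_mulVec_eq (x := x) (c := Real.exp c) _ hx (Real.exp_pos c).le,
    Real.log_exp]
  · exact funext fun i => (diagonal_exp_mul_mulVec B γ x i).trans (h i)
  · exact fun i j => by
      rw [diagonal_exp_mul_apply]
      exact (mul_pos (Real.exp_pos _) (hB i j)).le

/-- The Perron eigenvector of `diag(e^γ) B`. -/
theorem exists_logRho_eigenvector (hB : ∀ i j, 0 < B i j) (γ : Fin L → ℝ) :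
    ∃ x : Fin L → ℝ, (∀ i, 0 < x i) ∧
      ∀ i, Real.exp (γ i) * B.mulVec x i = Real.exp (logRho B γ) * x i := by
  obtain ⟨x, hx, r, hr, h⟩ := exists_pos_eigenvector
    (A := Matrix.diagonal (fun l => Real.exp (γ l)) * B) fun i j => by
      rw [diagonal_exp_mul_apply]
      exact mul_pos (Real.exp_pos _) (hB i j)
  have hi : ∀ i, Real.exp (γ i) * B.mulVec x i = Real.exp (Real.log r) * x i := fun i => by
    rw [Real.exp_log hr, ← diagonal_exp_mul_mulVec, h, Pi.smul_apply, smul_eq_mul]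
  exact ⟨x, hx, by rwa [logRho_eq_of_eigenvector hB hx hi]⟩

theorem logRho_le_of_mulVec_le (hB : ∀ i j, 0 < B i j) {γ x : Fin L → ℝ}
    (hx : ∀ i, 0 < x i) {c : ℝ} (h : ∀ i, Real.exp (γ i) * B.mulVec x i ≤ Real.exp c * x i) :
    logRho B γ ≤ c := by
  have hpos : ∀ i j, 0 < (Matrix.diagonal (fun l => Real.exp (γ l)) * B) i j := fun i j => by
    rw [diagonal_exp_mul_apply]
    exact mul_pos (Real.exp_pos _) (hB i j)
  -- The Perron root shows the spectral radius is positive, without which `Real.log` takes a default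
  -- value.
  obtain ⟨u, hu, r, hr, hur⟩ := exists_pos_eigenvector hpos
  have hr' := specRadius_eq_of_mulVec_eq (fun i j => (hpos i j).le) hu hr.le hur
  rw [logRho, Real.log_le_iff_le_exp (hr' ▸ hr)]
  refine specRadius_le_of_mulVec_le (fun i j => (hpos i j).le) hx (Real.exp_pos c).le fun i => ?_
  rw [diagonal_exp_mul_mulVec]
  exact h i

theorem logRho_add_const (hB : ∀ i j, 0 < B i j) (γ : Fin L → ℝ) (t : ℝ) :
    logRho B (fun l => γ l + t) = logRho B γ + t := by
  obtain ⟨x, hx, h⟩ := exists_logRho_eigenvector hB γ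
  refine logRho_eq_of_eigenvector hB hx fun i => ?_
  rw [Real.exp_add, Real.exp_add, mul_right_comm, h i]
  ring

theorem log_eq_of_eigenvector (hB : ∀ i j, 0 < B i j) {γ x : Fin L → ℝ} (hx : ∀ i, 0 < x i)
    {c : ℝ} (h : ∀ i, Real.exp (γ i) * B.mulVec x i = Real.exp c * x i) (i : Fin L) :
    Real.log (B.mulVec x i) = c + Real.log (x i) - γ i := by
  have := congrArg Real.log (h i)
  rw [Real.log_mul (Real.exp_pos _).ne' (mulVec_pos hB hx i).ne',
    Real.log_mul (Real.exp_pos _).ne' (hx i).ne', Real.log_exp, Real.log_exp] at this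
  linarith

/-- Hölder's inequality for weighted geometric means of two positive vectors. -/
theorem mulVec_geom_mean_le (hB : ∀ i j, 0 < B i j) {x x' : Fin L → ℝ} (hx : ∀ i, 0 < x i)
    (hx' : ∀ i, 0 < x' i) {a b : ℝ} (ha : 0 ≤ a) (hb : 0 ≤ b) (hab : a + b = 1) (i : Fin L) :
    B.mulVec (fun j => Real.exp (a * Real.log (x j) + b * Real.log (x' j))) i ≤
      Real.exp (a * Real.log (B.mulVec x i) + b * Real.log (B.mulVec x' i)) := by
  have hp0 : 0 < B.mulVec x i := mulVec_pos hB hx i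
  have hp0' : 0 < B.mulVec x' i := mulVec_pos hB hx' i
  -- The normalizers are made opaque so that unfolding `mulVec` below leaves them alone; each term
  -- is then weighted AM–GM for `x j / p` and `x' j / p'`.
  obtain ⟨p, hp⟩ : ∃ p, p = B.mulVec x i := ⟨_, rfl⟩
  obtain ⟨p', hp'⟩ : ∃ p', p' = B.mulVec x' i := ⟨_, rfl⟩
  rw [← hp, ← hp']
  rw [← hp] at hp0
  rw [← hp'] at hp0'
  have hterm : ∀ j, Real.exp (a * Real.log (x j) + b * Real.log (x' j)) ≤
      Real.exp (a * Real.log p + b * Real.log p') * (a * (x j / p) + b * (x' j / p')) := by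
    intro j
    have h := convexOn_exp.2 (Set.mem_univ (Real.log (x j / p)))
      (Set.mem_univ (Real.log (x' j / p'))) ha hb hab
    rw [Real.exp_log (div_pos (hx j) hp0), Real.exp_log (div_pos (hx' j) hp0'),
      Real.log_div (hx j).ne' hp0.ne', Real.log_div (hx' j).ne' hp0'.ne'] at h
    simp only [smul_eq_mul] at h
    refine le_trans (le_of_eq ?_) (mul_le_mul_of_nonneg_left h (Real.exp_pos _).le)
    rw [← Real.exp_add]
    congr 1
    ring
  calc B.mulVec (fun j => Real.exp (a * Real.log (x j) + b * Real.log (x' j))) i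
      ≤ ∑ j, B i j * (Real.exp (a * Real.log p + b * Real.log p') *
          (a * (x j / p) + b * (x' j / p'))) :=
        Finset.sum_le_sum (s := Finset.univ) fun j _ =>
          mul_le_mul_of_nonneg_left (hterm j) (hB i j).le
    _ = Real.exp (a * Real.log p + b * Real.log p') *
          (a * (B.mulVec x i / p) + b * (B.mulVec x' i / p')) := by
        simp only [Matrix.mulVec, dotProduct, Finset.sum_div, Finset.mul_sum,
          ← Finset.sum_add_distrib]
        exact Finset.sum_congr rfl fun j _ => by ring
    _ = _ := by
        rw [← hp, ← hp', div_self hp0.ne', div_self hp0'.ne', mul_one, mul_one, hab, mul_one]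

/-- By Hölder, the weighted geometric mean of the two Perron vectors is a Collatz–Wielandt test
vector for the convex combination. -/
theorem convexOn_logRho (hB : ∀ i j, 0 < B i j) : ConvexOn ℝ Set.univ (logRho B) := by
  refine ⟨convex_univ, fun γ _ γ' _ a b ha hb hab => ?_⟩
  obtain ⟨x, hx, h⟩ := exists_logRho_eigenvector hB γ
  obtain ⟨x', hx', h'⟩ := exists_logRho_eigenvector hB γ'
  refine logRho_le_of_mulVec_le hB (fun i => Real.exp_pos _) fun i =>
    (mul_le_mul_of_nonneg_left (mulVec_geom_mean_le hB hx hx' ha hb hab i)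
      (Real.exp_pos _).le).trans (le_of_eq ?_)
  rw [log_eq_of_eigenvector hB hx h, log_eq_of_eigenvector hB hx' h', ← Real.exp_add,
    ← Real.exp_add]
  congr 1
  simp only [Pi.add_apply, Pi.smul_apply, smul_eq_mul]
  ring

end PowerControl

/-! ### The fixed-point iteration -/

namespace PowerControl

variable {L : ℕ} {B : Matrix (Fin L) (Fin L) ℝ} {w y : Fin L → ℝ}

theorem step_eq (B : Matrix (Fin L) (Fin L) ℝ) (w y z : Fin L → ℝ) :
    step B w y z = fun l => w l * y l /
      B.transpose.mulVec (fun i => w i * y i / B.mulVec z i) l := by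
  funext l
  simp only [step, Matrix.mulVec, dotProduct, Matrix.transpose_apply]
  congr 1
  exact Finset.sum_congr rfl fun i _ => by ring

theorem IsPositiveSolution.smul {z : Fin L → ℝ} (h : IsPositiveSolution B w y z) {t : ℝ}
    (ht : 0 < t) : IsPositiveSolution B w y (t • z) := by
  refine ⟨fun l => mul_pos ht (h.1 l), fun l => (Finset.sum_congr rfl fun i _ => ?_).trans (h.2 l)⟩
  have : ∑ j, B i j * (t • z) j = t * ∑ j, B i j * z j := by
    rw [Finset.mul_sum]
    exact Finset.sum_congr rfl fun j _ => by simp only [Pi.smul_apply, smul_eq_mul]; ring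
  rw [this, Pi.smul_apply, smul_eq_mul, mul_left_comm, mul_div_mul_left _ _ ht.ne']

theorem IsPositiveSolution.sum_eq {z : Fin L → ℝ} (h : IsPositiveSolution B w y z) (l : Fin L) :
    ∑ i, w i * y i * (B i l * z l / B.mulVec z i) = w l * y l := h.2 l

theorem mulVec_smul_div {z : Fin L → ℝ} {t : ℝ} (ht : 0 < t) (l : Fin L) :
    (t • z) l / B.mulVec (t • z) l = z l / B.mulVec z l := by
  rw [Matrix.mulVec_smul, Pi.smul_apply, Pi.smul_apply, smul_eq_mul, smul_eq_mul,
    mul_div_mul_left _ _ ht.ne']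

variable [Nonempty (Fin L)]

theorem step_denom_pos (hB : ∀ i j, 0 < B i j) (hw : ∀ l, 0 < w l) (hy : ∀ l, 0 < y l)
    {z : Fin L → ℝ} (hz : ∀ l, 0 < z l) (l : Fin L) :
    0 < B.transpose.mulVec (fun i => w i * y i / B.mulVec z i) l :=
  mulVec_pos (fun i j => hB j i)
    (fun i => div_pos (mul_pos (hw i) (hy i)) (mulVec_pos hB hz i)) l

theorem step_pos (hB : ∀ i j, 0 < B i j) (hw : ∀ l, 0 < w l) (hy : ∀ l, 0 < y l)
    {z : Fin L → ℝ} (hz : ∀ l, 0 < z l) (l : Fin L) : 0 < step B w y z l := by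
  rw [step_eq]
  exact div_pos (mul_pos (hw l) (hy l)) (step_denom_pos hB hw hy hz l)

theorem isPositiveSolution_iff (hB : ∀ i j, 0 < B i j) (hw : ∀ l, 0 < w l) (hy : ∀ l, 0 < y l)
    {z : Fin L → ℝ} : IsPositiveSolution B w y z ↔ (∀ l, 0 < z l) ∧ step B w y z = z := by
  refine and_congr_right fun hz => ?_
  rw [funext_iff]
  refine forall_congr' fun l => ?_
  rw [step_eq, div_eq_iff (step_denom_pos hB hw hy hz l).ne', eq_comm]
  refine Eq.congr_right ?_
  simp only [Matrix.mulVec, dotProduct, Matrix.transpose_apply, Finset.mul_sum]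
  exact Finset.sum_congr rfl fun i _ => by ring

theorem SpreadLE.step {κ E : ℝ} (hB : ∀ i j, 0 < B i j) (hw : ∀ l, 0 < w l)
    (hy : ∀ l, 0 < y l) (hκ0 : 0 ≤ κ) (hcr : CrossRatioBound κ B)
    {z z' : Fin L → ℝ} (hE : 0 ≤ E) (hz : ∀ l, 0 < z l) (hz' : ∀ l, 0 < z' l)
    (h : SpreadLE E z z') : SpreadLE (κ * E) (step B w y z) (step B w y z') := by
  have hv : ∀ l, 0 < w l * y l := fun l => mul_pos (hw l) (hy l)
  have h1 := (SpreadLE.mulVec hB hκ0 hcr hz hz' hE h).div hv (mulVec_pos hB hz)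
    (mulVec_pos hB hz')
  -- For `Bᵀ` nonexpansiveness is enough, and with constant 1 the cross-ratio bound is just
  -- positivity.
  have h2 : SpreadLE (1 * (κ * E)) _ _ := SpreadLE.mulVec (A := B.transpose) (fun i j => hB j i)
    zero_le_one (fun i j k l => by
      rw [sub_self, zero_mul]; exact (mul_pos (hB _ _) (hB _ _)).le)
    (fun i => div_pos (hv i) (mulVec_pos hB hz i))
    (fun i => div_pos (hv i) (mulVec_pos hB hz' i)) (mul_nonneg hκ0 hE) h1
  rw [one_mul] at h2
  rw [step_eq, step_eq]
  exact h2.div hv (step_denom_pos hB hw hy hz) (step_denom_pos hB hw hy hz')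

/-- Moving `Bᵀ` across the dot product cancels `B z`. Consequently `step z` can be neither strictly
above nor strictly below `z` in all coordinates, which fixes the scale without normalization. -/
theorem sum_mul_step_denom (hB : ∀ i j, 0 < B i j) {z : Fin L → ℝ} (hz : ∀ l, 0 < z l) :
    ∑ l, z l * B.transpose.mulVec (fun i => w i * y i / B.mulVec z i) l = ∑ l, w l * y l := by
  change z ⬝ᵥ B.transpose.mulVec _ = _
  rw [Matrix.dotProduct_mulVec, Matrix.vecMul_transpose]
  exact Finset.sum_congr rfl fun i _ => mul_div_cancel₀ _ (mulVec_pos hB hz i).ne'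

theorem exists_step_le (hB : ∀ i j, 0 < B i j) (hw : ∀ l, 0 < w l) (hy : ∀ l, 0 < y l)
    {z : Fin L → ℝ} (hz : ∀ l, 0 < z l) : ∃ l, step B w y z l ≤ z l := by
  by_contra! h
  refine (Finset.sum_lt_sum_of_nonempty Finset.univ_nonempty fun l _ => ?_).ne
    (sum_mul_step_denom (w := w) (y := y) hB hz)
  have hl := h l
  rwa [step_eq, lt_div_iff₀ (step_denom_pos hB hw hy hz l)] at hl

theorem exists_le_step (hB : ∀ i j, 0 < B i j) (hw : ∀ l, 0 < w l) (hy : ∀ l, 0 < y l)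
    {z : Fin L → ℝ} (hz : ∀ l, 0 < z l) : ∃ l, z l ≤ step B w y z l := by
  by_contra! h
  refine (Finset.sum_lt_sum_of_nonempty Finset.univ_nonempty fun l _ => ?_).ne'
    (sum_mul_step_denom (w := w) (y := y) hB hz)
  have hl := h l
  rwa [step_eq, div_lt_iff₀ (step_denom_pos hB hw hy hz l)] at hl

theorem continuousAt_step (hB : ∀ i j, 0 < B i j) (hw : ∀ l, 0 < w l) (hy : ∀ l, 0 < y l)
    {z : Fin L → ℝ} (hz : ∀ l, 0 < z l) : ContinuousAt (step B w y) z := by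
  have hmul : ∀ A : Matrix (Fin L) (Fin L) ℝ, Continuous A.mulVec := fun A =>
    continuous_const.matrix_mulVec continuous_id
  rw [funext (step_eq B w y)]
  refine continuousAt_pi.2 fun l => continuousAt_const.div ?_ (step_denom_pos hB hw hy hz l).ne'
  refine ((continuous_apply l).comp (hmul B.transpose)).continuousAt.comp
    (f := fun z i => w i * y i / B.mulVec z i) (continuousAt_pi.2 fun i => ?_)
  exact continuousAt_const.div ((continuous_apply i).comp (hmul B)).continuousAt
    (mulVec_pos hB hz i).ne'

theorem exists_geometric_rate (hB : ∀ i j, 0 < B i j) (hw : ∀ l, 0 < w l) (hy : ∀ l, 0 < y l) :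
    ∃ q : ℝ, 0 < q ∧ q < 1 ∧ ∀ z₀ : Fin L → ℝ, (∀ l, 0 < z₀ l) →
      ∃ z, IsPositiveSolution B w y z ∧
        ∃ C : ℝ, ∀ (k : ℕ) (l : Fin L), |((step B w y)^[k] z₀) l - z l| ≤ C * q ^ k := by
  obtain ⟨κ, hκ0, hκ1, hcr⟩ := exists_crossRatioBound hB
  refine ⟨κ, hκ0, hκ1, fun z₀ hz₀ => ?_⟩
  have hk : ∀ k l, 0 < (step B w y)^[k] z₀ l := fun k => by
    induction k with
    | zero => exact hz₀
    | succ k ih => rw [Function.iterate_succ_apply']; exact step_pos hB hw hy ih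
  obtain ⟨z, hz, C, hC⟩ := exists_geometric_limit (S := step B w y) hκ0 hκ1
    (fun z hz => step_pos hB hw hy hz)
    (fun E z z' hE hz hz' h => h.step hB hw hy hκ0.le hcr hE hz hz') hz₀
    (fun k => by rw [Function.iterate_succ_apply']; exact exists_step_le hB hw hy (hk k))
    (fun k => by rw [Function.iterate_succ_apply']; exact exists_le_step hB hw hy (hk k))
  exact ⟨z, (isPositiveSolution_iff hB hw hy).2 ⟨hz, isFixedPt_of_tendsto_iterate
    (tendsto_of_geometric_bound hκ0.le hκ1 hC) (continuousAt_step hB hw hy hz)⟩, C, hC⟩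

/-! ### Entropy inequality, uniqueness and optimality -/

/-- The entropy inequality behind optimality, together with its equality case. -/
theorem IsPositiveSolution.sum_log_le (hB : ∀ i j, 0 < B i j) (hw : ∀ l, 0 < w l)
    (hy : ∀ l, 0 < y l) {z : Fin L → ℝ} (h : IsPositiveSolution B w y z) {x : Fin L → ℝ}
    (hx : ∀ l, 0 < x l) :
    ∑ l, w l * y l * Real.log (x l / B.mulVec x l) ≤
        ∑ l, w l * y l * Real.log (z l / B.mulVec z l) ∧
      (∑ l, w l * y l * Real.log (x l / B.mulVec x l) =
        ∑ l, w l * y l * Real.log (z l / B.mulVec z l) → ∃ t : ℝ, 0 < t ∧ x = t • z) := by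
  have hz := h.1
  have hBx := mulVec_pos hB hx
  have hBz := mulVec_pos hB hz
  let p : Fin L → Fin L → ℝ := fun i j => w i * y i * (B i j * z j / B.mulVec z i)
  have hp : ∀ i j, 0 < p i j := fun i j =>
    mul_pos (mul_pos (hw i) (hy i)) (div_pos (mul_pos (hB i j) (hz j)) (hBz i))
  have hrow : ∀ i, ∑ j, p i j = w i * y i := fun i => by
    simp only [p]
    rw [← Finset.mul_sum, ← Finset.sum_div]
    exact (congrArg _ (div_self (hBz i).ne')).trans (mul_one _)
  have hcol : ∀ j, ∑ i, p i j = w j * y j := h.sum_eq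
  -- Multiplying `p` by `s` replaces `z` by `x` and preserves row sums, so `s - 1` has `p`-sum zero;
  -- the marginals of `p` turn `∑ p * log s` into the difference of the two objectives.
  let s : Fin L → Fin L → ℝ := fun i j => x j / z j / (B.mulVec x i / B.mulVec z i)
  have hs : ∀ i j, 0 < s i j := fun i j =>
    div_pos (div_pos (hx j) (hz j)) (div_pos (hBx i) (hBz i))
  have hsum0 : ∑ i, ∑ j, p i j * (s i j - 1) = 0 := by
    refine Finset.sum_eq_zero fun i _ => ?_
    have : ∀ j, p i j * s i j = w i * y i * (B i j * x j / B.mulVec x i) := fun j => by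
      have := (hz j).ne'
      have := (hBx i).ne'
      have := (hBz i).ne'
      simp only [p, s]
      field_simp
    simp only [mul_sub, mul_one, Finset.sum_sub_distrib, this, hrow]
    rw [← Finset.mul_sum, ← Finset.sum_div]
    exact sub_eq_zero.2 ((congrArg _ (div_self (hBx i).ne')).trans (mul_one _))
  have hlog : ∀ i j, Real.log (s i j) = (Real.log (x j) - Real.log (z j)) -
      (Real.log (B.mulVec x i) - Real.log (B.mulVec z i)) := fun i j => by
    simp only [s]
    rw [Real.log_div (div_pos (hx j) (hz j)).ne' (div_pos (hBx i) (hBz i)).ne',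
      Real.log_div (hx j).ne' (hz j).ne', Real.log_div (hBx i).ne' (hBz i).ne']
  have hsumlog : ∑ i, ∑ j, p i j * Real.log (s i j) =
      ∑ l, w l * y l * Real.log (x l / B.mulVec x l) -
        ∑ l, w l * y l * Real.log (z l / B.mulVec z l) := by
    simp only [hlog, mul_sub (p _ _), Finset.sum_sub_distrib, ← Finset.sum_mul, hrow]
    rw [Finset.sum_comm, Finset.sum_comm (f := fun i j => p i j * Real.log (z j))]
    simp only [← Finset.sum_mul, hcol, ← Finset.sum_sub_distrib]
    refine Finset.sum_congr rfl fun l _ => ?_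
    rw [Real.log_div (hx l).ne' (hBx l).ne', Real.log_div (hz l).ne' (hBz l).ne']
    ring
  have hterm : ∀ i j, p i j * Real.log (s i j) ≤ p i j * (s i j - 1) := fun i j =>
    mul_le_mul_of_nonneg_left (Real.log_le_sub_one_of_pos (hs i j)) (hp i j).le
  have hinner : ∀ i, ∑ j, p i j * Real.log (s i j) ≤ ∑ j, p i j * (s i j - 1) := fun i =>
    Finset.sum_le_sum fun j _ => hterm i j
  refine ⟨sub_nonpos.1 ?_, fun heq => ?_⟩
  · rw [← hsumlog, ← hsum0]
    exact Finset.sum_le_sum fun i _ => hinner i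
  · rw [← sub_eq_zero, ← hsumlog, ← hsum0,
      Finset.sum_eq_sum_iff_of_le fun i _ => hinner i] at heq
    obtain ⟨i⟩ := ‹Nonempty (Fin L)›
    have hi := (Finset.sum_eq_sum_iff_of_le fun j _ => hterm i j).1 (heq i (Finset.mem_univ i))
    -- Equality forces `s = 1`; a single row already makes `x j / z j` independent of `j`.
    refine ⟨B.mulVec x i / B.mulVec z i, div_pos (hBx i) (hBz i), funext fun j => ?_⟩
    have hj := mul_left_cancel₀ (hp i j).ne' (hi j (Finset.mem_univ j))
    have hs1 : s i j = 1 := by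
      by_contra hne
      exact (Real.log_lt_sub_one_of_pos (hs i j) hne).ne hj
    rw [div_eq_one_iff_eq (div_pos (hBx i) (hBz i)).ne', div_eq_iff (hz j).ne'] at hs1
    exact hs1

/-- Each solution maximizes the same functional, so the equality case applies. -/
theorem IsPositiveSolution.eq_smul (hB : ∀ i j, 0 < B i j) (hw : ∀ l, 0 < w l)
    (hy : ∀ l, 0 < y l) {z z' : Fin L → ℝ} (h : IsPositiveSolution B w y z)
    (h' : IsPositiveSolution B w y z') : ∃ t : ℝ, 0 < t ∧ z' = t • z :=
  (h.sum_log_le hB hw hy h'.1).2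
    (le_antisymm (h.sum_log_le hB hw hy h'.1).1 (h'.sum_log_le hB hw hy h.1).1)

theorem logRho_logRatio (hB : ∀ i j, 0 < B i j) {z : Fin L → ℝ} (hz : ∀ l, 0 < z l) :
    logRho B (logRatio B z) = 0 := by
  refine logRho_eq_of_eigenvector hB hz fun i => ?_
  have hi := mulVec_pos hB hz i
  rw [logRatio, Real.exp_log (div_pos (hz i) hi), div_mul_cancel₀ _ hi.ne', Real.exp_zero, one_mul]

theorem IsPositiveSolution.objective_le (hB : ∀ i j, 0 < B i j) (hw : ∀ l, 0 < w l)
    (hy : ∀ l, 0 < y l) {z : Fin L → ℝ} (h : IsPositiveSolution B w y z) (γ : Fin L → ℝ) :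
    objective w y γ ≤ (∑ l, w l * y l) * logRho B γ + objective w y (logRatio B z) ∧
      (objective w y γ = (∑ l, w l * y l) * logRho B γ + objective w y (logRatio B z) →
        γ = fun l => logRatio B z l + logRho B γ) := by
  obtain ⟨x, hx, hxγ⟩ := exists_logRho_eigenvector hB γ
  have hγ : ∀ l, γ l = logRho B γ + Real.log (x l / B.mulVec x l) := fun l => by
    rw [Real.log_div (hx l).ne' (mulVec_pos hB hx l).ne', log_eq_of_eigenvector hB hx hxγ]
    ring
  have hobj : objective w y γ = (∑ l, w l * y l) * logRho B γ +
      ∑ l, w l * y l * Real.log (x l / B.mulVec x l) := by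
    rw [objective, Finset.sum_mul, ← Finset.sum_add_distrib]
    exact Finset.sum_congr rfl fun l _ => by rw [← mul_add, ← hγ]
  obtain ⟨hle, heq⟩ := h.sum_log_le hB hw hy hx
  rw [hobj]
  refine ⟨add_le_add_right hle _, fun he => ?_⟩
  obtain ⟨t, ht, rfl⟩ := heq (add_left_cancel he)
  funext l
  rw [hγ l, mulVec_smul_div ht, add_comm]
  rfl

theorem IsPositiveSolution.isOptimal_iff (hB : ∀ i j, 0 < B i j) (hw : ∀ l, 0 < w l)
    (hy : ∀ l, 0 < y l) {z : Fin L → ℝ} (h : IsPositiveSolution B w y z) (γ : Fin L → ℝ) :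
    IsOptimal B w y γ ↔ γ = logRatio B z := by
  have hV : 0 < ∑ l, w l * y l :=
    Finset.sum_pos (fun l _ => mul_pos (hw l) (hy l)) Finset.univ_nonempty
  have h0 := logRho_logRatio hB h.1
  constructor
  · rintro ⟨hfeas, hopt⟩
    obtain ⟨hle, heq⟩ := h.objective_le hB hw hy γ
    have hge := hopt _ h0.le
    -- Comparison with `logRatio B z` gives `0 ≤ V * logRho B γ` with `V > 0`, so the constraint is
    -- active.
    have hρ : logRho B γ = 0 := by nlinarith
    rw [heq (by rw [hρ] at hle ⊢; linarith)]
    simp [hρ]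
  · rintro rfl
    refine ⟨h0.le, fun γ' hγ' => ?_⟩
    have hle := (h.objective_le hB hw hy γ').1
    nlinarith

/-! ### Lagrange duality -/

theorem dualFunction_eq_bot (hB : ∀ i j, 0 < B i j) {lam : ℝ} (hne : lam ≠ ∑ l, w l * y l) :
    dualFunction B w y lam = ⊥ := by
  refine (EReal.eq_bot_iff_forall_lt _).2 fun c => ?_
  set d := lam - ∑ l, w l * y l with hd
  have hd0 : d ≠ 0 := sub_ne_zero.2 hne
  -- Along constant vectors the Lagrangian is affine with slope `lam - V`, hence unbounded below
  -- unless `lam = V`. The `0 +` matches the shape of `logRho_add_const`.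
  have hshift : ∀ t, lagrangian B w y (fun _ => 0 + t) lam =
      lam * logRho B (fun _ => 0) + d * t := by
    intro t
    rw [lagrangian, logRho_add_const hB (fun _ => 0) t, objective, ← Finset.sum_mul]
    ring
  refine lt_of_le_of_lt (iInf_le _ fun _ => 0 + (c - 1 - lam * logRho B (fun _ => 0)) / d) ?_
  rw [EReal.coe_lt_coe_iff, hshift, mul_div_cancel₀ _ hd0]
  linarith

theorem IsPositiveSolution.dualFunction_eq (hB : ∀ i j, 0 < B i j) (hw : ∀ l, 0 < w l)
    (hy : ∀ l, 0 < y l) {z : Fin L → ℝ} (h : IsPositiveSolution B w y z) :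
    dualFunction B w y (∑ l, w l * y l) =
      ((-objective w y (logRatio B z) : ℝ) : EReal) := by
  refine le_antisymm ?_ (le_iInf fun γ => ?_)
  · refine (iInf_le _ (logRatio B z)).trans (le_of_eq ?_)
    rw [lagrangian, logRho_logRatio hB h.1, mul_zero, add_zero]
  · rw [EReal.coe_le_coe_iff, lagrangian]
    linarith [(h.objective_le hB hw hy γ).1]

theorem IsPositiveSolution.isDualOptimal_iff (hB : ∀ i j, 0 < B i j) (hw : ∀ l, 0 < w l)
    (hy : ∀ l, 0 < y l) {z : Fin L → ℝ} (h : IsPositiveSolution B w y z) (lam : ℝ) :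
    IsDualOptimal B w y lam ↔ lam = ∑ l, w l * y l := by
  have hV : 0 ≤ ∑ l, w l * y l := Finset.sum_nonneg fun l _ => (mul_pos (hw l) (hy l)).le
  constructor
  · rintro ⟨-, hmax⟩
    by_contra hne
    have hle := hmax _ hV
    rw [dualFunction_eq_bot hB hne, h.dualFunction_eq hB hw hy, le_bot_iff] at hle
    exact EReal.coe_ne_bot _ hle
  · rintro rfl
    refine ⟨hV, fun mu _ => ?_⟩
    by_cases hmu : mu = ∑ l, w l * y l
    · rw [hmu]
    · rw [dualFunction_eq_bot hB hmu]
      exact bot_le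

end PowerControl

theorem lemma1 {L : ℕ} (hL : 1 ≤ L)
    (G : Matrix (Fin L) (Fin L) ℝ) (hG : ∀ l j, 0 ≤ G l j) (hGdiag : ∀ l, 0 < G l l)
    (n m w y : Fin L → ℝ) (P : ℝ)
    (hn : ∀ l, 0 < n l) (hm : ∀ l, 0 < m l) (hP : 0 < P)
    (hw : ∀ l, 0 < w l) (hy : ∀ l, 0 < y l)
    (B : Matrix (Fin L) (Fin L) ℝ) (hB : B = PowerControl.constraintMatrix G n m P) :
    -- the constraint function is convex, so that the subproblem is a convex program
    ConvexOn ℝ Set.univ (PowerControl.logRho B) ∧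
    -- the fixed-point equation has a positive solution, unique up to positive multiples
    (∃ z, PowerControl.IsPositiveSolution B w y z) ∧
    (∀ z, PowerControl.IsPositiveSolution B w y z →
      ∀ z', PowerControl.IsPositiveSolution B w y z' ↔ ∃ t : ℝ, 0 < t ∧ z' = t • z) ∧
    -- it yields the optimal solution of the subproblem, which is unique
    (∀ z, PowerControl.IsPositiveSolution B w y z →
      ∀ γ : Fin L → ℝ, PowerControl.IsOptimal B w y γ ↔ γ = PowerControl.logRatio B z) ∧
    -- from every positive start the iteration converges geometrically to a positive solution
    (∃ q : ℝ, 0 < q ∧ q < 1 ∧ ∀ z₀ : Fin L → ℝ, (∀ l, 0 < z₀ l) →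
      ∃ z, PowerControl.IsPositiveSolution B w y z ∧
        ∃ C : ℝ, ∀ (k : ℕ) (l : Fin L),
          |((PowerControl.step B w y)^[k] z₀) l - z l| ≤ C * q ^ k) ∧
    -- the dual problem has the unique optimal solution `∑ w_l y_l`, with no duality gap
    (∀ lam : ℝ, PowerControl.IsDualOptimal B w y lam ↔ lam = ∑ l, w l * y l) ∧
    (∀ γ : Fin L → ℝ, PowerControl.IsOptimal B w y γ →
      PowerControl.dualFunction B w y (∑ l, w l * y l) =
        ((-PowerControl.objective w y γ : ℝ) : EReal)) := by
  have : Nonempty (Fin L) := ⟨⟨0, hL⟩⟩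
  have hBpos : ∀ i j, 0 < B i j := hB ▸ PowerControl.constraintMatrix_pos hG hGdiag hn hm hP
  have hrate := PowerControl.exists_geometric_rate hBpos hw hy
  -- Existence is read off as the limit of the iteration started at the all-ones vector.
  obtain ⟨z, hz⟩ : ∃ z, PowerControl.IsPositiveSolution B w y z := by
    obtain ⟨q, -, -, hq⟩ := hrate
    obtain ⟨z, hz, -⟩ := hq (fun _ => 1) fun _ => one_pos
    exact ⟨z, hz⟩
  refine ⟨PowerControl.convexOn_logRho hBpos, ⟨z, hz⟩, fun x hx x' => ⟨fun hx' =>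
    hx.eq_smul hBpos hw hy hx', ?_⟩, fun x hx => hx.isOptimal_iff hBpos hw hy, hrate,
    hz.isDualOptimal_iff hBpos hw hy, fun γ hγ => ?_⟩
  · rintro ⟨t, ht, rfl⟩
    exact hx.smul ht
  · rw [(hz.isOptimal_iff hBpos hw hy γ).1 hγ]
    exact hz.dualFunction_eq hBpos hw hy
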